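/- Let $k$ be a field, let $n\ge 0$ be an integer and let $I\subseteq k[x_1,\dots,x_n]$ be any ideal, homogeneous or not. For $\omega\in\mathbb{R}^n$ and a polynomial $f$, let $\mathrm{in}_\omega(f)$ be the sum of all terms of $f$ whose exponent vectors maximize $\langle\omega,\cdot\rangle$ among the exponent vectors of $f$ (with $\mathrm{in}_\omega(0)=0$), and let $\mathrm{in}_\omega(I)=\langle \mathrm{in}_\omega(f): f\in I\rangle$. Call $u,v\in\mathbb{R}^n$ equivalent if $\mathrm{in}_u(I)=\mathrm{in}_v(I)$. A polyhedron in $\mathbb{R}^n$ is a set $\{x: Ax\le b\}$, and a polyhedral cone is a set $\{x: Ax\le 0\}$, where $A$ is a real matrix and $b$ is a real vector; a face of a polyhedron $P$ is either the empty set or a non-empty set of maximizers over $P$ of a linear form. The Gröbner fan of $I$ is the collection of the closures in $\mathbb{R}^n$ of all equivalence classes that contain a vector of the positive orthant $\mathbb{R}_{>0}^n$, together with all non-empty proper faces of these closures. Then the Gröbner fan of $I$ is a polyhedral complex of cones, that is, a fan: every member is a polyhedral cone, every non-empty face of a member is a member, and the intersection of any two members is a face of both. -/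

import Mathlib

open MvPolynomial

noncomputable section

namespace GroebnerFan

/-! ### Polyhedra, faces, polyhedral complexes and fans in `ℝⁿ` -/

/-- A polyhedron in `ℝⁿ`: a set of the form `{x | A x ≤ b}`. -/
def IsPolyhedron {n : ℕ} (P : Set (Fin n → ℝ)) : Prop :=
  ∃ (m : ℕ) (A : Matrix (Fin m) (Fin n) ℝ) (b : Fin m → ℝ), P = {x | A.mulVec x ≤ b}

/-- A polyhedral cone in `ℝⁿ`: a set of the form `{x | A x ≤ 0}`. -/
def IsPolyhedralCone {n : ℕ} (P : Set (Fin n → ℝ)) : Prop :=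
  ∃ (m : ℕ) (A : Matrix (Fin m) (Fin n) ℝ), P = {x | A.mulVec x ≤ 0}

/-- The set of points of `P` at which the linear form `⟨ω, ·⟩` attains its maximum over `P`
(empty if there is no maximum). -/
def face {n : ℕ} (ω : Fin n → ℝ) (P : Set (Fin n → ℝ)) : Set (Fin n → ℝ) :=
  {p | p ∈ P ∧ ∀ q ∈ P, ω ⬝ᵥ q ≤ ω ⬝ᵥ p}

/-- `F` is a face of `P`: it is empty, or it is non-empty and the set of maximizers over `P` of
a linear form. -/
def IsFace {n : ℕ} (P F : Set (Fin n → ℝ)) : Prop :=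
  F = ∅ ∨ (F.Nonempty ∧ ∃ ω : Fin n → ℝ, F = face ω P)

/-- A collection of polyhedra in `ℝⁿ` is a polyhedral complex if it contains all non-empty faces
of its members and the intersection of any two members is a face of both. -/
structure IsPolyhedralComplex {n : ℕ} (C : Set (Set (Fin n → ℝ))) : Prop where
  isPolyhedron : ∀ P ∈ C, IsPolyhedron P
  face_mem : ∀ P ∈ C, ∀ F, IsFace P F → F.Nonempty → F ∈ C
  inter_isFace : ∀ A ∈ C, ∀ B ∈ C, IsFace A (A ∩ B) ∧ IsFace B (A ∩ B)

/-- A fan is a polyhedral complex all of whose members are polyhedral cones. -/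
structure IsFan {n : ℕ} (C : Set (Set (Fin n → ℝ))) : Prop where
  isPolyhedralComplex : IsPolyhedralComplex C
  isPolyhedralCone : ∀ P ∈ C, IsPolyhedralCone P

/-! ### Initial forms, initial ideals and the Gröbner fan -/

open scoped Classical in
/-- The initial form `in_ω(f)`: the sum of all terms of `f` whose exponent vectors maximize
`⟨ω, ·⟩` among the exponent vectors of `f`. Here `Finsupp.weight ω a = ∑ i, a i * ω i`. -/
def initialForm {k : Type*} [Field k] {n : ℕ} (ω : Fin n → ℝ) (f : MvPolynomial (Fin n) k) :
    MvPolynomial (Fin n) k :=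
  ∑ a ∈ f.support with ∀ b ∈ f.support, Finsupp.weight ω b ≤ Finsupp.weight ω a,
    monomial a (coeff a f)

/-- The initial ideal `in_ω(I)`, generated by the initial forms of all elements of `I`. -/
def initialIdeal {k : Type*} [Field k] {n : ℕ} (ω : Fin n → ℝ)
    (I : Ideal (MvPolynomial (Fin n) k)) : Ideal (MvPolynomial (Fin n) k) :=
  Ideal.span {g | ∃ f ∈ I, g = initialForm ω f}

/-- The equivalence class of `v` under `u ∼ v ↔ in_u(I) = in_v(I)`. -/
def equivClass {k : Type*} [Field k] {n : ℕ} (I : Ideal (MvPolynomial (Fin n) k))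
    (v : Fin n → ℝ) : Set (Fin n → ℝ) :=
  {u | initialIdeal u I = initialIdeal v I}

/-- The Gröbner fan of `I`: the closures of the equivalence classes that contain a vector with
strictly positive coordinates, together with all non-empty proper faces of these closures. -/
def groebnerFan {k : Type*} [Field k] {n : ℕ} (I : Ideal (MvPolynomial (Fin n) k)) :
    Set (Set (Fin n → ℝ)) :=
  {C | ∃ v : Fin n → ℝ, (∀ i, 0 < v i) ∧
    (C = closure (equivClass I v) ∨
      (C.Nonempty ∧ C ≠ closure (equivClass I v) ∧ IsFace (closure (equivClass I v)) C))}

end GroebnerFan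

end

/-! Fix a positive weight `v` and refine it to a term order by breaking ties lexicographically.
Positivity makes this order well-founded, so division works even when `I` is not homogeneous. Let
`M` be the set of leading exponents of `I`. Every `m ∈ M` has a unique reduced element `g m ∈ I`
with coefficient 1 at `m` and no other exponent in `M`; these elements form a `k`-basis of `I`.

Call a weight `u` dominant if `m` has maximal `u`-weight in `g m` for every `m ∈ M`. Then the forms
`in_u (g m)` are a basis of `in_u(I)`, reduced with respect to the same `M`. No term order for `u`
is needed, so `u` may have negative coordinates. By uniqueness of reduced bases, two dominant
weights are equivalent exactly when they cut out the same initial forms of all `g m`, and a weight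
equivalent to a dominant one is dominant (`IsDominant.initialIdeal_eq_iff`,
`IsDominant.of_initialIdeal_eq`). Hence a class is determined by which inequalities `weight b ≤
weight m` are equalities. By Dickson's lemma and `rel_of_generators`, finitely many inequalities
suffice. Adding the equalities that hold at `v` gives a cone whose strata are equivalence classes
(`exists_stratification`).

The closure of a stratum is a face. The class of a point does not depend on the cone used to
describe it, so two cones have the same minimal face at a common point; this makes them meet along
faces (`isFan_of_stratification`). -/

namespace GroebnerFan

/-! ### Cones given by finitely many linear inequalities -/

section Cones

variable {n : ℕ} {J : Type*}

/-- The cone `{x | ∀ j, ⟨d j, x⟩ ≤ 0}`. -/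
def coneOf (d : J → Fin n → ℝ) : Set (Fin n → ℝ) :=
  {x | ∀ j, d j ⬝ᵥ x ≤ 0}

/-- The points of `coneOf d` at which all inequalities active at `p` are active. -/
def minFace (d : J → Fin n → ℝ) (p : Fin n → ℝ) : Set (Fin n → ℝ) :=
  {y | y ∈ coneOf d ∧ ∀ j, d j ⬝ᵥ p = 0 → d j ⬝ᵥ y = 0}

/-- The points of `coneOf d` at which exactly the inequalities active at `p` are active. -/
def stratum (d : J → Fin n → ℝ) (p : Fin n → ℝ) : Set (Fin n → ℝ) :=
  {y | y ∈ coneOf d ∧ ∀ j, d j ⬝ᵥ p = 0 ↔ d j ⬝ᵥ y = 0}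

open scoped Classical in
/-- Inequalities defining `minFace d p`. -/
noncomputable def faceIneqs (d : J → Fin n → ℝ) (p : Fin n → ℝ) : J ⊕ J → Fin n → ℝ :=
  Sum.elim d fun j => if d j ⬝ᵥ p = 0 then -d j else 0

variable {d : J → Fin n → ℝ} {p q x y : Fin n → ℝ}

theorem zero_mem_coneOf : (0 : Fin n → ℝ) ∈ coneOf d := fun j => by simp

theorem add_mem_coneOf (hx : x ∈ coneOf d) (hy : y ∈ coneOf d) : x + y ∈ coneOf d := fun j => by
  rw [dotProduct_add]
  exact add_nonpos (hx j) (hy j)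

theorem smul_mem_coneOf (hx : x ∈ coneOf d) {c : ℝ} (hc : 0 ≤ c) : c • x ∈ coneOf d := fun j => by
  rw [dotProduct_smul]
  exact mul_nonpos_of_nonneg_of_nonpos hc (hx j)

theorem isClosed_coneOf : IsClosed (coneOf d) := by
  simp only [coneOf, Set.ofPred_forall]
  refine isClosed_iInter fun j => isClosed_le ?_ continuous_const
  exact continuous_const.dotProduct continuous_id

theorem isPolyhedralCone_coneOf [Finite J] : IsPolyhedralCone (coneOf d) := by
  cases nonempty_fintype J
  refine ⟨Fintype.card J, fun i => d ((Fintype.equivFin J).symm i), ?_⟩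
  ext x
  refine ⟨fun h i => h _, fun h j => ?_⟩
  have := h (Fintype.equivFin J j)
  simpa [Matrix.mulVec] using this

theorem IsPolyhedralCone.isPolyhedron {P : Set (Fin n → ℝ)} (h : IsPolyhedralCone P) :
    IsPolyhedron P := by
  obtain ⟨m, A, rfl⟩ := h
  exact ⟨m, A, 0, rfl⟩

theorem minFace_eq_coneOf (d : J → Fin n → ℝ) (p : Fin n → ℝ) :
    minFace d p = coneOf (faceIneqs d p) := by
  ext y
  constructor
  · rintro ⟨h, h'⟩ (j | j)
    · exact h j
    · by_cases hj : d j ⬝ᵥ p = 0 <;> simp [faceIneqs, hj, h']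
  · intro h
    refine ⟨fun j => h (.inl j), fun j hj => le_antisymm (h (.inl j)) ?_⟩
    have := h (.inr j)
    simpa [faceIneqs, hj] using this

theorem minFace_subset (hq : q ∈ minFace d p) : minFace d q ⊆ minFace d p :=
  fun _ hy => ⟨hy.1, fun j hj => hy.2 j (hq.2 j hj)⟩

/-- A face of a face is a face: the equations that cut out the larger face already hold on the
smaller one. -/
theorem minFace_faceIneqs (hq : q ∈ minFace d p) :
    minFace (faceIneqs d p) q = minFace d q := by
  ext y
  constructor
  · rintro ⟨h, h'⟩
    exact ⟨fun j => h (.inl j), fun j => h' (.inl j)⟩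
  · intro h
    refine ⟨minFace_eq_coneOf d p ▸ minFace_subset hq h, ?_⟩
    rintro (j | j)
    · exact h.2 j
    · by_cases hj : d j ⬝ᵥ p = 0
      · simp [faceIneqs, hj, h.2 j (hq.2 j hj)]
      · simp [faceIneqs, hj]

/-- A set of points of `coneOf d` closed under addition has a point at which only those
inequalities are active that are active on the whole set. -/
theorem exists_generic [Finite J] {F : Set (Fin n → ℝ)} (hF : F.Nonempty) (hd : F ⊆ coneOf d)
    (hadd : ∀ x ∈ F, ∀ y ∈ F, x + y ∈ F) :
    ∃ p ∈ F, ∀ j, d j ⬝ᵥ p = 0 → ∀ y ∈ F, d j ⬝ᵥ y = 0 := by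
  classical
  cases nonempty_fintype J
  suffices H : ∀ s : Finset J, ∃ p ∈ F, ∀ j ∈ s, d j ⬝ᵥ p = 0 → ∀ y ∈ F, d j ⬝ᵥ y = 0 by
    simpa using H Finset.univ
  intro s
  induction s using Finset.induction_on with
  | empty => exact ⟨hF.some, hF.some_mem, by simp⟩
  | insert a s _ ih =>
    obtain ⟨p, hp, h⟩ := ih
    by_cases ha : ∀ y ∈ F, d a ⬝ᵥ y = 0
    · refine ⟨p, hp, fun j hj => ?_⟩
      rcases Finset.mem_insert.1 hj with rfl | hj
      · exact fun _ => ha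
      · exact h j hj
    · push Not at ha
      obtain ⟨y, hy, hay⟩ := ha
      -- A sum of two nonpositive values vanishes only if both do, so `p + y` keeps every strict
      -- inequality of `p` and gains that of `y` at `a`.
      refine ⟨p + y, hadd p hp y hy, fun j hj h0 => ?_⟩
      rw [dotProduct_add] at h0
      have h1 := hd hp j
      have h2 := hd hy j
      rcases Finset.mem_insert.1 hj with rfl | hj
      · exact absurd (by linarith) hay
      · exact h j hj (by linarith)

/-- The sum of the forms active at `p` is nonpositive on the cone and attains its maximum 0 exactly
where every summand vanishes. -/
theorem isFace_minFace [Finite J] (d : J → Fin n → ℝ) (p : Fin n → ℝ) :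
    IsFace (coneOf d) (minFace d p) := by
  classical
  cases nonempty_fintype J
  refine .inr ⟨⟨0, zero_mem_coneOf, fun j _ => by simp⟩, ∑ j with d j ⬝ᵥ p = 0, d j, ?_⟩
  ext y
  simp only [face, sum_dotProduct, Set.mem_ofPred_eq, minFace]
  refine and_congr_right fun hy => ?_
  constructor
  · intro h q hq
    rw [Finset.sum_eq_zero (f := fun i => d i ⬝ᵥ y) fun j hj => h j (Finset.mem_filter.1 hj).2]
    exact Finset.sum_nonpos fun j _ => hq j
  · intro h
    have h0 := h 0 zero_mem_coneOf
    simp only [dotProduct_zero, Finset.sum_const_zero] at h0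
    have h1 := (Finset.sum_eq_zero_iff_of_nonpos fun j _ => hy j).1
      (le_antisymm (Finset.sum_nonpos fun j _ => hy j) h0)
    exact fun j hj => h1 j (by simp [hj])

/-- On a cone, a form that attains its maximum has maximum 0. Take `p` generic in the face. If `y`
satisfies the equations active at `p`, then `c • p - y` stays in the cone for large `c`; since `ω`
vanishes at `p`, this gives `ω ⬝ᵥ y ≥ 0`. -/
theorem IsFace.exists_eq_minFace [Finite J] {F : Set (Fin n → ℝ)} (h : IsFace (coneOf d) F)
    (hF : F.Nonempty) : ∃ p ∈ coneOf d, F = minFace d p := by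
  obtain rfl | ⟨-, ω, rfl⟩ := h
  · simp at hF
  have hω0 : ∀ x ∈ face ω (coneOf d), ω ⬝ᵥ x = 0 := by
    rintro x ⟨hx, hm⟩
    have h0 := hm 0 zero_mem_coneOf
    have h2 := hm (x + x) (add_mem_coneOf hx hx)
    rw [dotProduct_add] at h2
    rw [dotProduct_zero] at h0
    linarith
  obtain ⟨z, hz⟩ := hF
  have hω : ∀ x ∈ coneOf d, ω ⬝ᵥ x ≤ 0 := fun x hx => (hz.2 x hx).trans (hω0 z hz).le
  obtain ⟨p, hp, hgen⟩ := exists_generic (d := d) (F := face ω (coneOf d)) ⟨z, hz⟩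
    (fun x hx => hx.1) fun x hx y hy => ⟨add_mem_coneOf hx.1 hy.1, fun q hq => by
      rw [dotProduct_add, hω0 x hx, hω0 y hy]
      simpa using hω q hq⟩
  refine ⟨p, hp.1, Set.Subset.antisymm (fun y hy => ⟨hy.1, fun j hj => hgen j hj y hy⟩) ?_⟩
  rintro y ⟨hy, hact⟩
  refine ⟨hy, fun q hq => (hω q hq).trans ?_⟩
  obtain ⟨c, hc, hcone⟩ : ∃ c : ℝ, 0 < c ∧ c • p - y ∈ coneOf d := by
    have H : ∀ j, ∃ c : ℝ, ∀ c' ≥ c, d j ⬝ᵥ (c' • p - y) ≤ 0 := by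
      intro j
      simp only [dotProduct_sub, dotProduct_smul, smul_eq_mul]
      by_cases hj : d j ⬝ᵥ p = 0
      · exact ⟨0, fun c' _ => by simp [hj, hact j hj]⟩
      · have hneg : d j ⬝ᵥ p < 0 := lt_of_le_of_ne (hp.1 j) hj
        refine ⟨(d j ⬝ᵥ y) / (d j ⬝ᵥ p), fun c' hc' => ?_⟩
        have := (div_le_iff_of_neg hneg).1 hc'
        linarith
    choose c hc using H
    cases nonempty_fintype J
    refine ⟨1 + ∑ j, |c j|, by positivity, fun j => hc j _ ?_⟩
    have h1 := Finset.single_le_sum (f := fun j => |c j|) (fun _ _ => abs_nonneg _)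
      (Finset.mem_univ j)
    have h2 := le_abs_self (c j)
    beta_reduce at h1
    linarith
  have := hω _ hcone
  rw [dotProduct_sub, dotProduct_smul, hω0 p hp, smul_zero] at this
  linarith

/-- A point `y` of the face is the limit of `y + c • p` as `c` decreases to 0, and these points have
exactly the active inequalities of `p`. -/
theorem closure_stratum (hp : p ∈ coneOf d) : closure (stratum d p) = minFace d p := by
  apply Set.Subset.antisymm
  · rw [minFace_eq_coneOf]
    refine closure_minimal ?_ isClosed_coneOf
    rw [← minFace_eq_coneOf]
    exact fun y hy => ⟨hy.1, fun j => (hy.2 j).1⟩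
  · intro y hy
    have hlim : Filter.Tendsto (fun c : ℝ => y + c • p) (nhdsWithin 0 (Set.Ioi 0)) (nhds y) := by
      have : Filter.Tendsto (fun c : ℝ => y + c • p) (nhds 0) (nhds (y + (0 : ℝ) • p)) :=
        Continuous.tendsto (by fun_prop) 0
      rw [zero_smul, add_zero] at this
      exact this.mono_left nhdsWithin_le_nhds
    refine mem_closure_of_tendsto hlim ?_
    filter_upwards [self_mem_nhdsWithin] with c hc
    have hc : 0 < c := hc
    refine ⟨add_mem_coneOf hy.1 (smul_mem_coneOf hp hc.le), fun j => ?_⟩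
    rw [dotProduct_add, dotProduct_smul, smul_eq_mul]
    refine ⟨fun h => by rw [hy.2 j h, h]; simp, fun h => ?_⟩
    have h1 := hy.1 j
    have h2 := mul_nonpos_of_nonneg_of_nonpos hc.le (hp j)
    exact (mul_eq_zero.1 (show c * (d j ⬝ᵥ p) = 0 by linarith)).resolve_left hc.ne'

end Cones

/-- Suppose that around every point `v` with property `V` the sets `E x` are the strata of a cone
given by finitely many inequalities. Then the closures of the sets `E v` and their faces form a
fan. -/
theorem isFan_of_stratification {n : ℕ} (V : (Fin n → ℝ) → Prop)
    (E : (Fin n → ℝ) → Set (Fin n → ℝ))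
    (hE : ∀ v, V v → ∃ (J : Type) (_ : Finite J) (d : J → Fin n → ℝ), v ∈ coneOf d ∧
      coneOf d ⊆ minFace d v ∧ ∀ x ∈ coneOf d, E x = stratum d x) :
    IsFan {C | ∃ v, V v ∧ (C = closure (E v) ∨
      (C.Nonempty ∧ C ≠ closure (E v) ∧ IsFace (closure (E v)) C))} := by
  set 𝓕 := {C | ∃ v, V v ∧ (C = closure (E v) ∨
      (C.Nonempty ∧ C ≠ closure (E v) ∧ IsFace (closure (E v)) C))} with h𝓕
  have key : ∀ C, C ∈ 𝓕 → ∃ (J : Type) (_ : Finite J) (d : J → Fin n → ℝ), (∃ p ∈ coneOf d,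
      C = minFace d p) ∧ (∀ p ∈ coneOf d, minFace d p ∈ 𝓕) ∧
      ∀ p ∈ coneOf d, minFace d p = closure (E p) := by
    rintro C ⟨v, hv, hC⟩
    obtain ⟨J, hJ, d, hvd, hgen, hstr⟩ := hE v hv
    have hcl : ∀ p ∈ coneOf d, minFace d p = closure (E p) := fun p hp => by
      rw [hstr p hp, closure_stratum hp]
    have hmin : minFace d v = coneOf d := Set.Subset.antisymm (fun _ h => h.1) hgen
    have hcone : closure (E v) = coneOf d := by rw [← hcl v hvd, hmin]
    rw [hcone] at hC
    refine ⟨J, hJ, d, ?_, fun p hp => ⟨v, hv, ?_⟩, hcl⟩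
    · rcases hC with rfl | ⟨hne, -, hf⟩
      · exact ⟨v, hvd, hmin.symm⟩
      · exact hf.exists_eq_minFace hne
    · rw [hcone]
      by_cases h : minFace d p = coneOf d
      · exact .inl h
      · exact .inr ⟨⟨p, hp, fun _ h => h⟩, h, isFace_minFace d p⟩
  have hcone : ∀ C ∈ 𝓕, IsPolyhedralCone C := by
    intro C hC
    obtain ⟨J, _, d, ⟨p, -, rfl⟩, -⟩ := key C hC
    rw [minFace_eq_coneOf]
    exact isPolyhedralCone_coneOf
  refine ⟨⟨fun C hC => (hcone C hC).isPolyhedron, ?_, ?_⟩, hcone⟩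
  · intro C hC F hF hne
    obtain ⟨J, _, d, ⟨p, -, rfl⟩, hmem, -⟩ := key C hC
    rw [minFace_eq_coneOf] at hF
    obtain ⟨q, hq, rfl⟩ := hF.exists_eq_minFace hne
    rw [← minFace_eq_coneOf] at hq
    rw [minFace_faceIneqs hq]
    exact hmem q hq.1
  · intro C hC D hD
    obtain ⟨J, _, d, ⟨p, -, rfl⟩, -, hd⟩ := key C hC
    obtain ⟨K, _, e, ⟨q, -, rfl⟩, -, he⟩ := key D hD
    obtain ⟨r, ⟨hrp, hrq⟩, hr⟩ := exists_generic (d := Sum.elim d e)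
      (F := minFace d p ∩ minFace e q)
      ⟨0, ⟨zero_mem_coneOf, fun j _ => by simp⟩, ⟨zero_mem_coneOf, fun j _ => by simp⟩⟩
      (fun x hx => by
        rintro (j | j)
        · exact hx.1.1 j
        · exact hx.2.1 j)
      (fun x hx y hy => by
        simp only [minFace_eq_coneOf] at hx hy ⊢
        exact ⟨add_mem_coneOf hx.1 hy.1, add_mem_coneOf hx.2 hy.2⟩)
    -- Both sides are the closure of `E r`, which mentions neither system of inequalities.
    have hde : minFace d r = minFace e r := by rw [hd r hrp.1, he r hrq.1]
    have hinter : minFace d p ∩ minFace e q = minFace d r := by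
      apply Set.Subset.antisymm
      · exact fun y hy => ⟨hy.1.1, fun j hj => hr (.inl j) hj y hy⟩
      · exact Set.subset_inter (minFace_subset hrp) (hde ▸ minFace_subset hrq)
    rw [hinter]
    constructor
    · rw [← minFace_faceIneqs hrp, minFace_eq_coneOf d p]
      exact isFace_minFace _ _
    · rw [hde, ← minFace_faceIneqs hrq, minFace_eq_coneOf e q]
      exact isFace_minFace _ _

variable {k : Type*} [Field k] {n : ℕ}

/-! ### Initial forms -/

section InitialForm

theorem coeff_initialForm_of_le {u : Fin n → ℝ} {f : MvPolynomial (Fin n) k} {c : ℝ}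
    {a : Fin n →₀ ℕ} (ha : coeff a f ≠ 0) (hac : Finsupp.weight u a = c)
    (hc : ∀ b, coeff b f ≠ 0 → Finsupp.weight u b ≤ c) (b : Fin n →₀ ℕ) :
    coeff b (initialForm u f) = if Finsupp.weight u b = c then coeff b f else 0 := by
  classical
  by_cases hb : coeff b f = 0
  · simp [initialForm, coeff_sum, coeff_monomial, hb]
  · simp only [initialForm, coeff_sum, coeff_monomial, Finset.sum_ite_eq', Finset.mem_filter,
      mem_support_iff, ne_eq, hb, not_false_eq_true, true_and]
    refine if_congr ⟨fun h => le_antisymm (hc b hb) (hac ▸ h a ha), fun h b' hb' => ?_⟩ rfl rfl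
    exact h ▸ hc b' hb'

@[simp]
theorem initialForm_zero (u : Fin n → ℝ) :
    initialForm u (0 : MvPolynomial (Fin n) k) = 0 := by
  simp [initialForm]

theorem exists_max_exponent {Γ : Type*} [LinearOrder Γ] (φ : (Fin n →₀ ℕ) → Γ)
    {f : MvPolynomial (Fin n) k} (hf : f ≠ 0) :
    ∃ a, coeff a f ≠ 0 ∧ ∀ b, coeff b f ≠ 0 → φ b ≤ φ a := by
  obtain ⟨a, ha, h⟩ := f.support.exists_max_image φ (support_nonempty.2 hf)
  exact ⟨a, mem_support_iff.1 ha, fun b hb => h b (mem_support_iff.2 hb)⟩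

theorem coeff_monomial_mul_ne_zero {c b : Fin n →₀ ℕ} {r : k} {f : MvPolynomial (Fin n) k}
    (h : coeff b (monomial c r * f) ≠ 0) : ∃ a, b = c + a ∧ coeff a f ≠ 0 := by
  rw [coeff_monomial_mul'] at h
  split_ifs at h with hcb
  · exact ⟨b - c, (add_tsub_cancel_of_le hcb).symm, right_ne_zero_of_mul h⟩
  · exact absurd rfl h

theorem monomial_mul_initialForm (u : Fin n → ℝ) (c : Fin n →₀ ℕ) (r : k)
    (f : MvPolynomial (Fin n) k) :
    monomial c r * initialForm u f = initialForm u (monomial c r * f) := by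
  by_cases hr : r = 0
  · simp [hr]
  by_cases hf : f = 0
  · simp [hf]
  obtain ⟨a, ha, hmax⟩ := exists_max_exponent (Finsupp.weight u) hf
  ext b
  rw [coeff_initialForm_of_le (a := c + a) (c := Finsupp.weight u (c + a)) _ rfl _]
  · rw [coeff_monomial_mul', coeff_monomial_mul']
    split_ifs with hcb h h
    · rw [coeff_initialForm_of_le ha rfl hmax, if_pos]
      rw [← add_tsub_cancel_of_le hcb, map_add, map_add] at h
      linarith
    · rw [coeff_initialForm_of_le ha rfl hmax, if_neg, mul_zero]
      rw [← add_tsub_cancel_of_le hcb, map_add, map_add] at h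
      exact fun h' => h (by rw [h'])
    · rfl
    · rfl
  · rw [coeff_monomial_mul]
    exact mul_ne_zero hr ha
  · intro b' hb'
    obtain ⟨a', rfl, ha'⟩ := coeff_monomial_mul_ne_zero hb'
    rw [map_add, map_add]
    exact add_le_add_right (hmax a' ha') _

end InitialForm

/-! ### The term order refining a positive weight -/

section TermOrder

/-- The exponents ordered by `⟨v, ·⟩`, ties being broken lexicographically. -/
noncomputable def termOrder (v : Fin n → ℝ) (a : Fin n →₀ ℕ) : ℝ ×ₗ Lex (Fin n →₀ ℕ) :=
  toLex (Finsupp.weight v a, toLex a)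

variable {v : Fin n → ℝ} {a b : Fin n →₀ ℕ}

theorem termOrder_injective (v : Fin n → ℝ) : Function.Injective (termOrder v) := fun a b h => by
  have := congrArg (fun x => ofLex (ofLex x).2) h
  simpa [termOrder] using this

theorem termOrder_add (v : Fin n → ℝ) (a b : Fin n →₀ ℕ) :
    termOrder v (a + b) = termOrder v a + termOrder v b := by
  simp [termOrder, ← toLex_add]

theorem termOrder_add_le (c : Fin n →₀ ℕ) (h : termOrder v a ≤ termOrder v b) :
    termOrder v (c + a) ≤ termOrder v (c + b) := by
  rw [termOrder_add, termOrder_add]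
  exact add_le_add_right h _

theorem weight_le_of_termOrder_le (h : termOrder v a ≤ termOrder v b) :
    Finsupp.weight v a ≤ Finsupp.weight v b := by
  rcases Prod.Lex.le_iff.1 h with h | h
  · exact le_of_lt h
  · exact h.1.le

theorem finite_weight_le (hv : ∀ i, 0 < v i) (c : ℝ) :
    {a : Fin n →₀ ℕ | Finsupp.weight v a ≤ c}.Finite := by
  refine (Set.finite_Iic (Finsupp.equivFunOnFinite.symm fun i => ⌊c / v i⌋₊)).subset ?_
  intro a ha i
  refine Nat.le_floor ((le_div_iff₀ (hv i)).2 (le_trans ?_ ha))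
  rw [Finsupp.weight_apply, Finsupp.sum_fintype _ _ (by simp)]
  have := Finset.single_le_sum (f := fun i => a i • v i)
    (fun i _ => nsmul_nonneg (hv i).le _) (Finset.mem_univ i)
  simpa using this

/-- Only finitely many exponents lie below a given one, because positive weights bound every
coordinate. -/
theorem wellFounded_termOrder (hv : ∀ i, 0 < v i) :
    WellFounded fun a b : Fin n →₀ ℕ => termOrder v a < termOrder v b := by
  refine WellFounded.wellFounded_iff_has_min.2 fun s ⟨a, ha⟩ => ?_
  obtain ⟨m, ⟨hms, hma⟩, hm⟩ := Set.exists_min_image {b | b ∈ s ∧ termOrder v b ≤ termOrder v a}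
    (termOrder v) ((finite_weight_le hv (Finsupp.weight v a)).subset fun b hb =>
      weight_le_of_termOrder_le hb.2) ⟨a, ha, le_rfl⟩
  exact ⟨m, hms, fun x hx hxm => (hm x ⟨hx, hxm.le.trans hma⟩).not_gt hxm⟩

end TermOrder

/-! ### Leading exponents and reduced elements -/

section Reduced

/-- The exponents of the leading terms of the elements of `I`. -/
def leadExps (v : Fin n → ℝ) (I : Ideal (MvPolynomial (Fin n) k)) : Set (Fin n →₀ ℕ) :=
  {a | ∃ f ∈ I, coeff a f ≠ 0 ∧ ∀ b, coeff b f ≠ 0 → termOrder v b ≤ termOrder v a}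

/-- `g` assigns to every `m ∈ M` an element `x ^ m - (terms with exponents outside M)` of the
subspace `W`, and no non-zero element of `W` has all its exponents outside `M`. -/
structure IsReducedFamily (W : Submodule k (MvPolynomial (Fin n) k)) (M : Set (Fin n →₀ ℕ))
    (g : (Fin n →₀ ℕ) → MvPolynomial (Fin n) k) : Prop where
  mem : ∀ m ∈ M, g m ∈ W
  coeff_self : ∀ m ∈ M, coeff m (g m) = 1
  coeff_of_ne : ∀ m ∈ M, ∀ b ∈ M, b ≠ m → coeff b (g m) = 0
  eq_zero : ∀ f ∈ W, (∀ m ∈ M, coeff m f = 0) → f = 0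

variable {v : Fin n → ℝ} {I : Ideal (MvPolynomial (Fin n) k)}

theorem eq_zero_of_coeff_leadExps {f : MvPolynomial (Fin n) k} (hf : f ∈ I)
    (h : ∀ m ∈ leadExps v I, coeff m f = 0) : f = 0 := by
  by_contra h0
  obtain ⟨a, ha, hmax⟩ := exists_max_exponent (termOrder v) h0
  exact ha (h a ⟨f, hf, ha, hmax⟩)

theorem exists_normalForm (hv : ∀ i, 0 < v i) (I : Ideal (MvPolynomial (Fin n) k))
    (a : Fin n →₀ ℕ) : ∃ r : MvPolynomial (Fin n) k, monomial a 1 - r ∈ I ∧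
      ∀ b, coeff b r ≠ 0 → b ∉ leadExps v I ∧ termOrder v b ≤ termOrder v a := by
  classical
  induction a using (wellFounded_termOrder hv).induction with
  | _ a ih =>
  by_cases ha : a ∈ leadExps v I
  · obtain ⟨f, hf, hfa, hmax⟩ := ha
    choose! r hrI hr using ih
    have hlt : ∀ b ∈ f.support.erase a, termOrder v b < termOrder v a := fun b hb => by
      rw [Finset.mem_erase, mem_support_iff] at hb
      exact lt_of_le_of_ne (hmax b hb.2) ((termOrder_injective v).ne hb.1)
    -- Modulo `I`, the leading monomial of `f` is minus its normalized lower terms; each of these is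
    -- replaced by its normal form.
    refine ⟨-∑ b ∈ f.support.erase a, C ((coeff a f)⁻¹ * coeff b f) * r b, ?_, fun b hb => ?_⟩
    · have hsum : monomial a 1 = C (coeff a f)⁻¹ * f -
          ∑ b ∈ f.support.erase a, C ((coeff a f)⁻¹ * coeff b f) * monomial b 1 := by
        conv_lhs => rw [← add_sub_cancel_right (monomial a (1 : k))
          (∑ b ∈ f.support.erase a, C ((coeff a f)⁻¹ * coeff b f) * monomial b 1)]
        congr 1
        rw [congrArg (C (coeff a f)⁻¹ * ·) f.as_sum, Finset.mul_sum,
          ← Finset.add_sum_erase _ _ (mem_support_iff.2 hfa), C_mul_monomial, inv_mul_cancel₀ hfa]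
        congr 1
        exact Finset.sum_congr rfl fun b _ => by rw [C_mul_monomial, C_mul_monomial, mul_one]
      rw [hsum, sub_neg_eq_add, sub_add, ← Finset.sum_sub_distrib]
      refine I.sub_mem (I.mul_mem_left _ hf) (I.sum_mem fun b hb => ?_)
      rw [← mul_sub]
      exact I.mul_mem_left _ (hrI b (hlt b hb))
    · rw [coeff_neg, coeff_sum] at hb
      obtain ⟨c, hc, hcb⟩ := Finset.exists_ne_zero_of_sum_ne_zero (neg_ne_zero.1 hb)
      rw [coeff_C_mul] at hcb
      have := hr c (hlt c hc) b (right_ne_zero_of_mul hcb)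
      exact ⟨this.1, this.2.trans (hlt c hc).le⟩
  · refine ⟨monomial a 1, by simp, fun b hb => ?_⟩
    rw [coeff_monomial] at hb
    obtain rfl : a = b := by
      by_contra h
      simp [h] at hb
    exact ⟨ha, le_rfl⟩

theorem exists_isReducedFamily (hv : ∀ i, 0 < v i) (I : Ideal (MvPolynomial (Fin n) k)) :
    ∃ g, IsReducedFamily (I.restrictScalars k) (leadExps v I) g ∧
      ∀ m ∈ leadExps v I, ∀ b, coeff b (g m) ≠ 0 → termOrder v b ≤ termOrder v m := by
  classical
  choose r hrI hr using exists_normalForm hv I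
  have hr0 : ∀ a, ∀ b ∈ leadExps v I, coeff b (r a) = 0 := fun a b hb => by
    by_contra h
    exact (hr a b h).1 hb
  refine ⟨fun m => monomial m 1 - r m, ⟨fun m _ => hrI m, fun m hm => ?_, fun m _ b hb hbm => ?_,
    fun f hf => eq_zero_of_coeff_leadExps hf⟩, fun m _ b hb => ?_⟩
  · simp [hr0 m m hm]
  · simp [coeff_monomial, hbm.symm, hr0 m b hb]
  · by_cases hbm : m = b
    · rw [hbm]
    · refine (hr m b fun h => hb ?_).2
      simp [coeff_monomial, hbm, h]

namespace IsReducedFamily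

variable {W : Submodule k (MvPolynomial (Fin n) k)} {M : Set (Fin n →₀ ℕ)}
  {g : (Fin n →₀ ℕ) → MvPolynomial (Fin n) k}

open scoped Classical in
theorem eq_sum (hg : IsReducedFamily W M g) {f : MvPolynomial (Fin n) k} (hf : f ∈ W) :
    f = ∑ m ∈ f.support with m ∈ M, coeff m f • g m := by
  rw [← sub_eq_zero]
  refine hg.eq_zero _ (W.sub_mem hf (W.sum_mem fun m hm =>
    W.smul_mem _ (hg.mem m (Finset.mem_filter.1 hm).2))) fun m hm => ?_
  rw [coeff_sub, coeff_sum, sub_eq_zero]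
  by_cases hmf : coeff m f = 0
  · rw [hmf, Finset.sum_eq_zero]
    intro a ha
    rw [Finset.mem_filter, mem_support_iff] at ha
    rw [coeff_smul, hg.coeff_of_ne a ha.2 m hm, smul_zero]
    rintro rfl
    exact ha.1 hmf
  · rw [Finset.sum_eq_single m]
    · simp [hg.coeff_self m hm]
    · intro a ha ham
      rw [coeff_smul, hg.coeff_of_ne a (Finset.mem_filter.1 ha).2 m hm ham.symm, smul_zero]
    · intro h
      exact absurd (by simp [hm, hmf]) h

theorem eq_of_coeff (hg : IsReducedFamily W M g) {f f' : MvPolynomial (Fin n) k} (hf : f ∈ W)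
    (hf' : f' ∈ W) (h : ∀ m ∈ M, coeff m f = coeff m f') : f = f' :=
  sub_eq_zero.1 <| hg.eq_zero _ (W.sub_mem hf hf') fun m hm => by
    rw [coeff_sub, h m hm, sub_self]

theorem of_span {h : (Fin n →₀ ℕ) → MvPolynomial (Fin n) k}
    (hself : ∀ m ∈ M, coeff m (h m) = 1) (hne : ∀ m ∈ M, ∀ b ∈ M, b ≠ m → coeff b (h m) = 0) :
    IsReducedFamily (Submodule.span k (h '' M)) M h where
  mem m hm := Submodule.subset_span ⟨m, hm, rfl⟩
  coeff_self := hself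
  coeff_of_ne := hne
  eq_zero f hf h0 := by
    obtain ⟨l, hl, rfl⟩ := (Finsupp.mem_span_image_iff_linearCombination k).1 hf
    suffices l = 0 by simp [this]
    ext m
    by_contra hlm
    have hm : m ∈ M := (Finsupp.mem_supported k l).1 hl (Finsupp.mem_support_iff.2 hlm)
    have := h0 m hm
    rw [Finsupp.linearCombination_apply, Finsupp.sum, coeff_sum, Finset.sum_eq_single m] at this
    · rw [coeff_smul, hself m hm, smul_eq_mul, mul_one] at this
      exact hlm this
    · intro a ha ham
      rw [coeff_smul, hne a ((Finsupp.mem_supported k l).1 hl ha) m hm ham.symm, smul_zero]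
    · intro ha
      simp [Finsupp.notMem_support_iff.1 ha]

end IsReducedFamily

/-- A transitive and translation invariant relation that relates the exponents of `g t` to `t` for
all `t` in a set generating `M` does so for all `t ∈ M`. -/
theorem rel_of_generators (hv : ∀ i, 0 < v i) {g : (Fin n →₀ ℕ) → MvPolynomial (Fin n) k}
    (hg : IsReducedFamily (I.restrictScalars k) (leadExps v I) g)
    (hle : ∀ m ∈ leadExps v I, ∀ b, coeff b (g m) ≠ 0 → termOrder v b ≤ termOrder v m)
    {T : Set (Fin n →₀ ℕ)} (hT : T ⊆ leadExps v I) (hTM : ∀ m ∈ leadExps v I, ∃ t ∈ T, t ≤ m)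
    {R : (Fin n →₀ ℕ) → (Fin n →₀ ℕ) → Prop}
    (htrans : ∀ a b c, R a b → R b c → R a c) (hadd : ∀ c a b, R a b → R (c + a) (c + b))
    (hR : ∀ t ∈ T, ∀ b, coeff b (g t) ≠ 0 → R b t) :
    ∀ m ∈ leadExps v I, ∀ b, coeff b (g m) ≠ 0 → R b m := by
  classical
  intro m
  induction m using (wellFounded_termOrder hv).induction with
  | _ m ih =>
  intro hm b hb
  obtain ⟨t, ht, htm⟩ := hTM m hm
  obtain ⟨c, rfl⟩ : ∃ c, m = c + t := ⟨m - t, (tsub_add_cancel_of_le htm).symm⟩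
  have hfR : ∀ a, coeff a (monomial c 1 * g t) ≠ 0 →
      R a (c + t) ∧ termOrder v a ≤ termOrder v (c + t) := by
    intro a ha
    obtain ⟨a, rfl, ha'⟩ := coeff_monomial_mul_ne_zero ha
    exact ⟨hadd _ _ _ (hR t ht a ha'), termOrder_add_le c (hle t (hT ht) a ha')⟩
  -- The translate of `g t` expands as `g (c + t)` plus multiples of `g a` with smaller `a`. If `b`
  -- is not an exponent of the translate, its term in `g (c + t)` is cancelled, so `b` occurs in
  -- such a `g a` and induction applies.
  by_cases hbf : coeff b (monomial c 1 * g t) = 0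
  · have hfI : monomial c 1 * g t ∈ I.restrictScalars k :=
      I.mul_mem_left _ (hg.mem t (hT ht))
    have hf := hg.eq_sum hfI
    have hcf : coeff (c + t) (monomial c 1 * g t) = 1 := by
      rw [coeff_monomial_mul, hg.coeff_self t (hT ht), one_mul]
    rw [← Finset.add_sum_erase _ _ (a := c + t) (by simp [hm, hcf]), hcf, one_smul] at hf
    have hb' := congrArg (coeff b) hf
    rw [hbf, coeff_add, coeff_sum] at hb'
    obtain ⟨a, ha, hab⟩ := Finset.exists_ne_zero_of_sum_ne_zero
      (s := ((monomial c 1 * g t).support.filter (· ∈ leadExps v I)).erase (c + t))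
      (f := fun a => coeff b (coeff a (monomial c 1 * g t) • g a))
      fun h => hb (by rw [h, add_zero] at hb'; exact hb'.symm)
    rw [Finset.mem_erase, Finset.mem_filter, mem_support_iff] at ha
    obtain ⟨hac, haf, haM⟩ := ha
    rw [coeff_smul] at hab
    have := hfR a haf
    exact htrans _ _ _ (ih a (lt_of_le_of_ne this.2 ((termOrder_injective v).ne hac)) haM b
      (right_ne_zero_of_mul hab)) this.1
  · exact (hfR b hbf).1

end Reduced

/-! ### Initial ideals with respect to weights that do not change the leading exponents -/

section InitialIdeal

variable {I : Ideal (MvPolynomial (Fin n) k)} {M : Set (Fin n →₀ ℕ)}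
  {g : (Fin n →₀ ℕ) → MvPolynomial (Fin n) k} {u y : Fin n → ℝ}

/-- For every `m ∈ M`, the exponent `m` is one of the exponents of `g m` of maximal weight. -/
def IsDominant (u : Fin n → ℝ) (M : Set (Fin n →₀ ℕ))
    (g : (Fin n →₀ ℕ) → MvPolynomial (Fin n) k) : Prop :=
  ∀ m ∈ M, ∀ b, coeff b (g m) ≠ 0 → Finsupp.weight u b ≤ Finsupp.weight u m

theorem IsDominant.coeff_initialForm (hu : IsDominant u M g)
    (hg : IsReducedFamily (I.restrictScalars k) M g) {m : Fin n →₀ ℕ} (hm : m ∈ M)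
    (b : Fin n →₀ ℕ) : coeff b (initialForm u (g m)) =
      if Finsupp.weight u b = Finsupp.weight u m then coeff b (g m) else 0 :=
  coeff_initialForm_of_le (a := m) (by simp [hg.coeff_self m hm]) rfl (hu m hm) b

theorem IsDominant.isReducedFamily_span (hu : IsDominant u M g)
    (hg : IsReducedFamily (I.restrictScalars k) M g) :
    IsReducedFamily (Submodule.span k ((fun m => initialForm u (g m)) '' M)) M
      fun m => initialForm u (g m) :=
  .of_span (fun m hm => by rw [hu.coeff_initialForm hg hm, if_pos rfl, hg.coeff_self m hm])
    fun m hm b hb hbm => by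
      rw [hu.coeff_initialForm hg hm, hg.coeff_of_ne m hm b hb hbm, ite_self]

/-- Expand `f` in the `g m`. By dominance no `g m` in the expansion exceeds the top weight of `f`,
so the top part of `f` comes only from the `initialForm u (g m)` with `m` of top weight. -/
theorem IsDominant.initialForm_mem_span (hu : IsDominant u M g)
    (hg : IsReducedFamily (I.restrictScalars k) M g) {f : MvPolynomial (Fin n) k} (hf : f ∈ I) :
    initialForm u f ∈ Submodule.span k ((fun m => initialForm u (g m)) '' M) := by
  classical
  by_cases h0 : f = 0
  · simp [h0]
  obtain ⟨a, ha, hmax⟩ := exists_max_exponent (Finsupp.weight u) h0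
  have hsum : initialForm u f = ∑ m ∈ f.support with m ∈ M,
      (if Finsupp.weight u m = Finsupp.weight u a then coeff m f else 0) •
        initialForm u (g m) := by
    ext b
    rw [coeff_initialForm_of_le ha rfl hmax, coeff_sum]
    have hfb : coeff b f = ∑ m ∈ f.support with m ∈ M, coeff m f * coeff b (g m) := by
      conv_lhs => rw [hg.eq_sum (f := f) hf]
      simp [coeff_sum]
    by_cases hb : Finsupp.weight u b = Finsupp.weight u a
    · rw [if_pos hb, hfb]
      refine Finset.sum_congr rfl fun m hm => ?_
      rw [Finset.mem_filter, mem_support_iff] at hm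
      rw [coeff_smul, hu.coeff_initialForm hg hm.2, hb, smul_eq_mul]
      by_cases hma : Finsupp.weight u m = Finsupp.weight u a
      · rw [if_pos hma, if_pos hma.symm]
      · rw [if_neg hma, zero_mul]
        by_cases hbm : coeff b (g m) = 0
        · rw [hbm, mul_zero]
        · exact absurd (le_antisymm (hmax m hm.1) (hb ▸ hu m hm.2 b hbm)) hma
    · rw [if_neg hb]
      refine (Finset.sum_eq_zero fun m hm => ?_).symm
      rw [coeff_smul, hu.coeff_initialForm hg (Finset.mem_filter.1 hm).2, smul_eq_mul]
      split_ifs with h1 h2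
      · exact absurd (h2.trans h1) hb
      all_goals simp
  rw [hsum]
  exact Submodule.sum_mem _ fun m hm => Submodule.smul_mem _ _
    (Submodule.subset_span ⟨m, (Finset.mem_filter.1 hm).2, rfl⟩)

/-- The span is already an ideal: a monomial times `initialForm u (g m)` is the initial form of
another element of `I`. -/
theorem IsDominant.initialIdeal_eq_span (hu : IsDominant u M g)
    (hg : IsReducedFamily (I.restrictScalars k) M g) :
    (initialIdeal u I).restrictScalars k =
      Submodule.span k ((fun m => initialForm u (g m)) '' M) := by
  apply le_antisymm
  · have hmon : ∀ (c : Fin n →₀ ℕ) (r : k),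
        ∀ x ∈ Submodule.span k ((fun m => initialForm u (g m)) '' M),
        monomial c r * x ∈ Submodule.span k ((fun m => initialForm u (g m)) '' M) := by
      intro c r x hx
      induction hx using Submodule.span_induction with
      | mem x hx =>
        obtain ⟨m, hm, rfl⟩ := hx
        rw [monomial_mul_initialForm]
        exact hu.initialForm_mem_span hg (I.mul_mem_left _ (hg.mem m hm))
      | zero => simp
      | add x y _ _ hx hy => rw [mul_add]; exact add_mem hx hy
      | smul s x _ hx => rw [mul_smul_comm]; exact Submodule.smul_mem _ _ hx
    intro x hx
    have hx' : x ∈ Submodule.span (MvPolynomial (Fin n) k) {g | ∃ f ∈ I, g = initialForm u f} := hx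
    clear hx
    induction hx' using Submodule.span_induction with
    | mem x hx =>
      obtain ⟨f, hf, rfl⟩ := hx
      exact hu.initialForm_mem_span hg hf
    | zero => exact zero_mem _
    | add x y _ _ hx hy => exact add_mem hx hy
    | smul p x _ hx =>
      rw [p.as_sum, smul_eq_mul, Finset.sum_mul]
      exact Submodule.sum_mem _ fun c _ => hmon c _ x hx
  · rw [Submodule.span_le]
    rintro _ ⟨m, hm, rfl⟩
    exact Ideal.subset_span ⟨g m, hg.mem m hm, rfl⟩

theorem IsDominant.isReducedFamily_initialIdeal (hu : IsDominant u M g)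
    (hg : IsReducedFamily (I.restrictScalars k) M g) :
    IsReducedFamily ((initialIdeal u I).restrictScalars k) M fun m => initialForm u (g m) := by
  rw [hu.initialIdeal_eq_span hg]
  exact hu.isReducedFamily_span hg

theorem initialForm_mem_initialIdeal {f : MvPolynomial (Fin n) k} (hf : f ∈ I) :
    initialForm y f ∈ initialIdeal y I :=
  Ideal.subset_span ⟨f, hf, rfl⟩

theorem coeff_initialForm_eq_zero_or (u : Fin n → ℝ) (f : MvPolynomial (Fin n) k)
    (b : Fin n →₀ ℕ) : coeff b (initialForm u f) = 0 ∨
      coeff b (initialForm u f) = coeff b f ∧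
        ∀ c, coeff c f ≠ 0 → Finsupp.weight u c ≤ Finsupp.weight u b := by
  by_cases hf : f = 0
  · simp [hf]
  obtain ⟨a, ha, hmax⟩ := exists_max_exponent (Finsupp.weight u) hf
  rw [coeff_initialForm_of_le ha rfl hmax]
  split_ifs with h
  · exact .inr ⟨rfl, h ▸ hmax⟩
  · exact .inl rfl

theorem initialForm_ne_zero (u : Fin n → ℝ) {f : MvPolynomial (Fin n) k} (hf : f ≠ 0) :
    initialForm u f ≠ 0 := by
  obtain ⟨a, ha, hmax⟩ := exists_max_exponent (Finsupp.weight u) hf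
  intro h
  have := coeff_initialForm_of_le ha rfl hmax a
  rw [if_pos rfl, h, coeff_zero] at this
  exact ha this.symm

/-- The nonzero form `initialForm y (g m)` lies in `in_u(I)`, so it has an exponent in `M`. The only
exponent of `g m` in `M` is `m`, which therefore has maximal `y`-weight. -/
theorem IsDominant.of_initialIdeal_eq (hu : IsDominant u M g)
    (hg : IsReducedFamily (I.restrictScalars k) M g) (h : initialIdeal y I = initialIdeal u I) :
    IsDominant y M g := by
  intro m hm
  have hmem : initialForm y (g m) ∈ (initialIdeal u I).restrictScalars k :=
    h ▸ initialForm_mem_initialIdeal (hg.mem m hm)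
  have hgm : g m ≠ 0 := fun h0 => by simpa [h0] using hg.coeff_self m hm
  have hex : ∃ a ∈ M, coeff a (initialForm y (g m)) ≠ 0 := by
    by_contra! hcon
    exact initialForm_ne_zero y hgm
      ((hu.isReducedFamily_initialIdeal hg).eq_zero _ hmem hcon)
  obtain ⟨a, ha, hne⟩ := hex
  obtain ⟨h1, h2⟩ := (coeff_initialForm_eq_zero_or y (g m) a).resolve_left hne
  obtain rfl : a = m := by
    by_contra ham
    exact hne (h1.trans (hg.coeff_of_ne m hm a ha ham))
  exact h2

theorem IsDominant.initialIdeal_eq_iff (hu : IsDominant u M g) (hy : IsDominant y M g)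
    (hg : IsReducedFamily (I.restrictScalars k) M g) :
    initialIdeal y I = initialIdeal u I ↔ ∀ m ∈ M, ∀ b, coeff b (g m) ≠ 0 →
      (Finsupp.weight u b = Finsupp.weight u m ↔ Finsupp.weight y b = Finsupp.weight y m) := by
  have hru := hu.isReducedFamily_initialIdeal hg
  have hry := hy.isReducedFamily_initialIdeal hg
  constructor
  · intro h m hm b hb
    rw [h] at hry
    have heq : initialForm y (g m) = initialForm u (g m) := by
      refine hru.eq_of_coeff (hry.mem m hm) (hru.mem m hm) fun a ha => ?_
      by_cases ham : a = m
      · rw [ham, hru.coeff_self m hm, hry.coeff_self m hm]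
      · rw [hru.coeff_of_ne m hm a ha ham, hry.coeff_of_ne m hm a ha ham]
    have := congrArg (coeff b) heq
    rw [hu.coeff_initialForm hg hm, hy.coeff_initialForm hg hm] at this
    split_ifs at this with h1 h2 h2 <;> simp_all
  · intro h
    apply Submodule.restrictScalars_injective k
    rw [hu.initialIdeal_eq_span hg, hy.initialIdeal_eq_span hg]
    congr 1
    refine Set.image_congr fun m hm => ?_
    ext b
    rw [hu.coeff_initialForm hg hm, hy.coeff_initialForm hg hm]
    by_cases hb : coeff b (g m) = 0
    · simp [hb]
    · exact if_congr (h m hm b hb).symm rfl rfl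

end InitialIdeal

/-! ### The Gröbner cones of positive weights -/

theorem dotProduct_exponent_sub (a b : Fin n →₀ ℕ) (x : Fin n → ℝ) :
    (fun i => (a i : ℝ) - b i) ⬝ᵥ x = Finsupp.weight x a - Finsupp.weight x b := by
  rw [Finsupp.weight_apply, Finsupp.weight_apply, Finsupp.sum_fintype _ _ (by simp),
    Finsupp.sum_fintype _ _ (by simp), ← Finset.sum_sub_distrib]
  simp [dotProduct, sub_mul]

/-- Dickson's lemma: the minimal elements form an antichain in a well-quasi-order. -/
theorem exists_finite_generators (M : Set (Fin n →₀ ℕ)) :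
    ∃ T : Finset (Fin n →₀ ℕ), (T : Set (Fin n →₀ ℕ)) ⊆ M ∧ ∀ m ∈ M, ∃ t ∈ T, t ≤ m := by
  have hfin : {a | Minimal (· ∈ M) a}.Finite :=
    WellQuasiOrderedLE.finite_of_isAntichain (setOfPred_minimal_antichain _)
  refine ⟨hfin.toFinset, fun a ha => ?_, fun m hm => ?_⟩
  · exact ((hfin.mem_toFinset).1 ha).prop
  · obtain ⟨t, htm, ht⟩ := exists_minimal_le_of_wellFoundedLT (· ∈ M) m hm
    exact ⟨t, hfin.mem_toFinset.2 ht, htm⟩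

/-- The weights near a positive weight `v` are stratified by their initial ideals as the faces of
a cone. -/
theorem exists_stratification {v : Fin n → ℝ} (hv : ∀ i, 0 < v i)
    (I : Ideal (MvPolynomial (Fin n) k)) :
    ∃ (J : Type) (_ : Finite J) (d : J → Fin n → ℝ), v ∈ coneOf d ∧
      coneOf d ⊆ minFace d v ∧ ∀ x ∈ coneOf d, equivClass I x = stratum d x := by
  classical
  obtain ⟨g, hg, hle⟩ := exists_isReducedFamily hv I
  obtain ⟨T, hTM, hT⟩ := exists_finite_generators (leadExps v I)
  let J := (t : T) × (g t).support
  let d₁ : J → Fin n → ℝ := fun j i => (j.2.1 i : ℝ) - j.1.1 i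
  -- Together with `d₁`, these turn the inequalities tight at `v` into equations, so `v` is generic
  -- in the cone.
  let d₂ : J → Fin n → ℝ := fun j =>
    if Finsupp.weight v j.2.1 = Finsupp.weight v j.1.1 then -d₁ j else 0
  have hd₁ : ∀ (j : J) (x : Fin n → ℝ),
      d₁ j ⬝ᵥ x = Finsupp.weight x j.2.1 - Finsupp.weight x j.1.1 := fun j x =>
    dotProduct_exponent_sub _ _ x
  have hvdom : IsDominant v (leadExps v I) g := fun m hm b hb =>
    weight_le_of_termOrder_le (hle m hm b hb)
  have ext_rel : ∀ x y : Fin n → ℝ,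
      (∀ t ∈ T, ∀ b, coeff b (g t) ≠ 0 → Finsupp.weight x b ≤ Finsupp.weight x t) →
      (∀ t ∈ T, ∀ b, coeff b (g t) ≠ 0 → Finsupp.weight y b ≤ Finsupp.weight y t) →
      (∀ t ∈ T, ∀ b, coeff b (g t) ≠ 0 → Finsupp.weight x b = Finsupp.weight x t →
        Finsupp.weight y b = Finsupp.weight y t) →
      ∀ m ∈ leadExps v I, ∀ b, coeff b (g m) ≠ 0 → Finsupp.weight x b ≤ Finsupp.weight x m ∧
        Finsupp.weight y b ≤ Finsupp.weight y m ∧ (Finsupp.weight x b = Finsupp.weight x m →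
        Finsupp.weight y b = Finsupp.weight y m) := by
    intro x y h1 h2 h3
    -- The inequalities belong to the relation because transitivity needs them: equality of
    -- `x`-weights at the ends of a chain then forces equality at each link.
    refine rel_of_generators hv hg hle hTM hT (R := fun b m =>
      Finsupp.weight x b ≤ Finsupp.weight x m ∧ Finsupp.weight y b ≤ Finsupp.weight y m ∧
      (Finsupp.weight x b = Finsupp.weight x m → Finsupp.weight y b = Finsupp.weight y m))
      ?_ ?_
      fun t ht b hb => ⟨h1 t ht b hb, h2 t ht b hb, h3 t ht b hb⟩
    · rintro a b c ⟨h1, h2, h3⟩ ⟨h1', h2', h3'⟩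
      refine ⟨h1.trans h1', h2.trans h2', fun h => ?_⟩
      rw [h3 (by linarith), h3' (by linarith)]
    · rintro c a b ⟨h1, h2, h3⟩
      simp only [map_add, add_le_add_iff_left, add_right_inj]
      exact ⟨h1, h2, h3⟩
  have mem_cone : ∀ x, x ∈ coneOf (Sum.elim d₁ d₂) ↔ ∀ t ∈ T, ∀ b, coeff b (g t) ≠ 0 →
      Finsupp.weight x b ≤ Finsupp.weight x t ∧
      (Finsupp.weight v b = Finsupp.weight v t → Finsupp.weight x b = Finsupp.weight x t) := by
    intro x
    constructor
    · intro hx t ht b hb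
      let j : J := ⟨⟨t, ht⟩, ⟨b, mem_support_iff.2 hb⟩⟩
      have h1 := hx (.inl j)
      have h2 := hx (.inr j)
      simp only [Sum.elim_inl, Sum.elim_inr, hd₁, d₂] at h1 h2
      refine ⟨by linarith, fun h => ?_⟩
      rw [if_pos h, neg_dotProduct, hd₁] at h2
      linarith
    · rintro hx (⟨⟨t, ht⟩, ⟨b, hb⟩⟩ | ⟨⟨t, ht⟩, ⟨b, hb⟩⟩)
      · have := hx t ht b (mem_support_iff.1 hb)
        simp only [Sum.elim_inl, hd₁]
        linarith
      · have := hx t ht b (mem_support_iff.1 hb)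
        simp only [Sum.elim_inr, d₂]
        split_ifs with h
        · rw [neg_dotProduct, hd₁]
          linarith [this.2 h]
        · simp
  have d₂_zero : ∀ x ∈ coneOf (Sum.elim d₁ d₂), ∀ j, d₂ j ⬝ᵥ x = 0 := by
    rintro x hx ⟨⟨t, ht⟩, ⟨b, hb⟩⟩
    have := (mem_cone x).1 hx t ht b (mem_support_iff.1 hb)
    simp only [d₂]
    split_ifs with h
    · rw [neg_dotProduct, hd₁, this.2 h, sub_self, neg_zero]
    · simp
  have hvcone : v ∈ coneOf (Sum.elim d₁ d₂) := (mem_cone v).2 fun t ht b hb =>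
    ⟨hvdom t (hTM ht) b hb, id⟩
  have ext_cone : ∀ x ∈ coneOf (Sum.elim d₁ d₂), ∀ m ∈ leadExps v I, ∀ b, coeff b (g m) ≠ 0 →
      Finsupp.weight x b ≤ Finsupp.weight x m ∧
      (Finsupp.weight v b = Finsupp.weight v m → Finsupp.weight x b = Finsupp.weight x m) := by
    intro x hx m hm b hb
    rw [mem_cone] at hx
    exact (ext_rel v x (fun t ht => hvdom t (hTM ht)) (fun t ht b hb => (hx t ht b hb).1)
      (fun t ht b hb => (hx t ht b hb).2) m hm b hb).2
  refine ⟨J ⊕ J, inferInstance, Sum.elim d₁ d₂, hvcone, fun x hx => ⟨hx, ?_⟩, fun x hx => ?_⟩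
  · rintro (⟨⟨t, ht⟩, ⟨b, hb⟩⟩ | j) h
    · simp only [Sum.elim_inl, hd₁, sub_eq_zero] at h ⊢
      exact ((mem_cone x).1 hx t ht b (mem_support_iff.1 hb)).2 h
    · exact d₂_zero x hx j
  · have hxdom : IsDominant x (leadExps v I) g := fun m hm b hb => (ext_cone x hx m hm b hb).1
    ext y
    constructor
    · intro hy
      have hy : initialIdeal y I = initialIdeal x I := hy
      have hydom := hxdom.of_initialIdeal_eq hg hy
      have hiff := (hxdom.initialIdeal_eq_iff hydom hg).1 hy
      have hycone : y ∈ coneOf (Sum.elim d₁ d₂) := (mem_cone y).2 fun t ht b hb =>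
        ⟨hydom t (hTM ht) b hb, fun h =>
          (hiff t (hTM ht) b hb).1 ((ext_cone x hx t (hTM ht) b hb).2 h)⟩
      refine ⟨hycone, ?_⟩
      rintro (⟨⟨t, ht⟩, ⟨b, hb⟩⟩ | j)
      · simp only [Sum.elim_inl, hd₁, sub_eq_zero]
        exact hiff t (hTM ht) b (mem_support_iff.1 hb)
      · simp only [Sum.elim_inr, d₂_zero x hx, d₂_zero y hycone]
    · rintro ⟨hycone, hact⟩
      have hydom : IsDominant y (leadExps v I) g := fun m hm b hb =>
        (ext_cone y hycone m hm b hb).1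
      have hact' : ∀ t ∈ T, ∀ b, coeff b (g t) ≠ 0 →
          (Finsupp.weight x b = Finsupp.weight x t ↔ Finsupp.weight y b = Finsupp.weight y t) := by
        intro t ht b hb
        have := hact (.inl ⟨⟨t, ht⟩, ⟨b, mem_support_iff.2 hb⟩⟩)
        simpa only [Sum.elim_inl, hd₁, sub_eq_zero] using this
      have hxT := fun t ht => hxdom t (hTM ht)
      have hyT := fun t ht => hydom t (hTM ht)
      exact (hxdom.initialIdeal_eq_iff hydom hg).2 fun m hm b hb =>
        ⟨(ext_rel x y hxT hyT (fun t ht b hb => (hact' t ht b hb).1) m hm b hb).2.2,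
          (ext_rel y x hyT hxT (fun t ht b hb => (hact' t ht b hb).2) m hm b hb).2.2⟩

end GroebnerFan

theorem theorem2 {k : Type*} [Field k] (n : ℕ) (I : Ideal (MvPolynomial (Fin n) k)) :
    GroebnerFan.IsFan (GroebnerFan.groebnerFan I) :=
  GroebnerFan.isFan_of_stratification (fun v => ∀ i, 0 < v i) (GroebnerFan.equivClass I)
    fun _ hv => GroebnerFan.exists_stratification hv I
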